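/- Let $\mathfrak g$ be a finite-dimensional complex simple Lie algebra with Killing form $(\cdot,\cdot)$. The affine-Virasoro Lie algebra of $\mathfrak g$ is the complex vector space $$\mathfrak L(\mathfrak g)=\mathfrak g\otimes\mathbb C[t^{\pm1}]\ \oplus\ \mathbb C K_1\ \oplus\ \mathbb C K_2\ \oplus\ \bigoplus_{m\in\mathbb Z}\mathbb C d_m$$ with the Lie bracket determined by $$[x\otimes t^m,y\otimes t^n]=[x,y]\otimes t^{m+n}+m\,(x,y)\,\delta_{m+n,0}K_1,\qquad [d_m,x\otimes t^n]=n\,x\otimes t^{m+n},$$ $$[d_m,d_n]=(n-m)\,d_{m+n}+\delta_{m+n,0}\,\frac{m^3-m}{12}K_2,\qquad [\mathfrak L(\mathfrak g),K_1]=[\mathfrak L(\mathfrak g),K_2]=0$$ for all $x,y\in\mathfrak g$ and $m,n\in\mathbb Z$. A biderivation of a Lie algebra $L$ over $\mathbb C$ is a $\mathbb C$-bilinear map $F:L\times L\to L$ such that $$F([x,y],z)=[x,F(y,z)]-[y,F(x,z)]\quad\text{and}\quad F(x,[y,z])=[y,F(x,z)]-[z,F(x,y)]$$ for all $x,y,z\in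 L$; it is inner if there is $\lambda\in\mathbb C$ with $F(x,y)=\lambda[x,y]$ for all $x,y\in L$. Then every biderivation of $\mathfrak L(\mathfrak g)$ is inner. -/

import Mathlib

noncomputable section

open scoped TensorProduct

/-- The operator `t ^ n ↦ n t ^ (m + n)` on `ℂ[t, t⁻¹]`. -/
def laurentShiftDeriv (m : ℤ) : AddMonoidAlgebra ℂ ℤ →ₗ[ℂ] AddMonoidAlgebra ℂ ℤ :=
  (AddMonoidAlgebra.basis ℤ ℂ).constr ℂ fun n => AddMonoidAlgebra.single (m + n) (n : ℂ)

/-- The action of the span of the `d_m` (finitely supported functions `ℤ →₀ ℂ`, with `d_m`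
corresponding to `Finsupp.single m 1`) on the loop algebra, given by
`d_m · (x ⊗ t ^ n) = n x ⊗ t ^ (m + n)`. -/
def wittAction (g : Type*) [LieRing g] [LieAlgebra ℂ g] :
    (ℤ →₀ ℂ) →ₗ[ℂ] LieAlgebra.loopAlgebra ℂ ℤ g →ₗ[ℂ] LieAlgebra.loopAlgebra ℂ ℤ g :=
  Finsupp.linearCombination ℂ fun m => (laurentShiftDeriv m).rTensor g

/-- The bilinear extension of `(d_m, d_n) ↦ (n - m) d_(m + n)`. -/
def wittBracket : (ℤ →₀ ℂ) →ₗ[ℂ] (ℤ →₀ ℂ) →ₗ[ℂ] (ℤ →₀ ℂ) :=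
  Finsupp.linearCombination ℂ fun m => Finsupp.linearCombination ℂ fun n =>
    Finsupp.single (m + n) ((n : ℂ) - m)

/-- The bilinear extension of `(d_m, d_n) ↦ δ_(m + n, 0) (m ^ 3 - m) / 12`. -/
def virasoroCocycle : (ℤ →₀ ℂ) →ₗ[ℂ] (ℤ →₀ ℂ) →ₗ[ℂ] ℂ :=
  Finsupp.linearCombination ℂ fun m => Finsupp.linearCombination ℂ fun n =>
    if m + n = 0 then ((m : ℂ) ^ 3 - m) / 12 else 0

/-- The Lie bracket of a Lie algebra as a bilinear map. -/
def lieBilinear (R L : Type*) [CommRing R] [LieRing L] [LieAlgebra R L] : L →ₗ[R] L →ₗ[R] L :=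
  LinearMap.mk₂ R (fun x y => ⁅x, y⁆) add_lie smul_lie lie_add lie_smul

/-- The Lie bracket of the loop algebra `ℂ[t, t⁻¹] ⊗ g` as a bilinear map. -/
def loopBracket (g : Type*) [LieRing g] [LieAlgebra ℂ g] :
    LieAlgebra.loopAlgebra ℂ ℤ g →ₗ[ℂ] LieAlgebra.loopAlgebra ℂ ℤ g →ₗ[ℂ]
      LieAlgebra.loopAlgebra ℂ ℤ g :=
  lieBilinear ℂ (LieAlgebra.loopAlgebra ℂ ℤ g)

/-- The bilinear form on the loop algebra with
`(x ⊗ t ^ m, y ⊗ t ^ n) ↦ m (x, y) δ_(m + n, 0)`, where `(x, y)` is the Killing form of `g`. -/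
def affineCocycle (g : Type*) [LieRing g] [LieAlgebra ℂ g] :
    LinearMap.BilinForm ℂ (LieAlgebra.loopAlgebra ℂ ℤ g) :=
  (LieAlgebra.LoopAlgebra.residuePairing ℂ ℤ g (killingForm ℂ g)).flip

/-- The underlying vector space `g ⊗ ℂ[t, t⁻¹] ⊕ ℂ K₁ ⊕ ℂ K₂ ⊕ ⨁ ℂ d_m` of the affine-Virasoro
Lie algebra of `g`: `loop` is the component in the loop algebra, `k₁` and `k₂` are the coefficients
of `K₁` and `K₂`, and `vir m` is the coefficient of `d_m`. -/
@[ext]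
structure AffineVirasoro (g : Type*) [LieRing g] [LieAlgebra ℂ g] where
  loop : LieAlgebra.loopAlgebra ℂ ℤ g
  k₁ : ℂ
  k₂ : ℂ
  vir : ℤ →₀ ℂ

section Identities

theorem laurentShiftDeriv_single (m n : ℤ) :
    laurentShiftDeriv m (AddMonoidAlgebra.single n 1) =
      AddMonoidAlgebra.single (m + n) (n : ℂ) := by
  have := (AddMonoidAlgebra.basis ℤ ℂ).constr_basis ℂ
    (fun n => (AddMonoidAlgebra.single (m + n) (n : ℂ) : AddMonoidAlgebra ℂ ℤ)) n
  simpa only [laurentShiftDeriv, AddMonoidAlgebra.basis_apply] using this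

variable {g : Type*} [LieRing g] [LieAlgebra ℂ g]

theorem wittAction_single (m n : ℤ) (x : g) :
    wittAction g (Finsupp.single m 1) (AddMonoidAlgebra.single n 1 ⊗ₜ[ℂ] x) =
      (n : ℂ) • (AddMonoidAlgebra.single (m + n) (1 : ℂ) ⊗ₜ[ℂ] x) := by
  rw [wittAction, Finsupp.linearCombination_single, one_smul, LinearMap.rTensor_tmul,
    laurentShiftDeriv_single, TensorProduct.smul_tmul', AddMonoidAlgebra.smul_single,
    smul_eq_mul, mul_one]

theorem wittBracket_single (m n : ℤ) :
    wittBracket (Finsupp.single m 1) (Finsupp.single n 1) =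
      ((n : ℂ) - m) • Finsupp.single (m + n) (1 : ℂ) := by
  simp [wittBracket]

theorem virasoroCocycle_single (m n : ℤ) :
    virasoroCocycle (Finsupp.single m 1) (Finsupp.single n 1) =
      if m + n = 0 then ((m : ℂ) ^ 3 - m) / 12 else 0 := by
  simp [virasoroCocycle]

theorem affineCocycle_single (m n : ℤ) (x y : g) :
    affineCocycle g (AddMonoidAlgebra.single m 1 ⊗ₜ[ℂ] x) (AddMonoidAlgebra.single n 1 ⊗ₜ[ℂ] y) =
      if m + n = 0 then (m : ℂ) * killingForm ℂ g x y else 0 := by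
  have h : (Finsupp.single n y : ℤ →₀ g) (-m) = if m + n = 0 then y else 0 := by
    rw [Finsupp.single_apply]; congr 1; exact propext (by omega)
  change LieAlgebra.LoopAlgebra.residuePairing ℂ ℤ g (killingForm ℂ g)
    (AddMonoidAlgebra.single n 1 ⊗ₜ[ℂ] y) (AddMonoidAlgebra.single m 1 ⊗ₜ[ℂ] x) = _
  rw [LieAlgebra.LoopAlgebra.residuePairing_apply_apply,
    LieAlgebra.LoopAlgebra.toFinsupp_single_tmul, LieAlgebra.LoopAlgebra.toFinsupp_single_tmul,
    Finsupp.sum_single_index (by simp), h]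
  split_ifs with h0
  · rw [LieModule.traceForm_comm]; simp
  · simp

theorem loopBracket_single (m n : ℤ) (x y : g) :
    loopBracket g (AddMonoidAlgebra.single m (1 : ℂ) ⊗ₜ[ℂ] x)
      (AddMonoidAlgebra.single n (1 : ℂ) ⊗ₜ[ℂ] y) =
      AddMonoidAlgebra.single (m + n) (1 : ℂ) ⊗ₜ[ℂ] ⁅x, y⁆ := by
  change (AddMonoidAlgebra.single m (1 : ℂ) * AddMonoidAlgebra.single n (1 : ℂ)) ⊗ₜ[ℂ] ⁅x, y⁆ = _
  rw [AddMonoidAlgebra.single_mul_single, mul_one]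

theorem loopBracket_self (f : LieAlgebra.loopAlgebra ℂ ℤ g) : loopBracket g f f = 0 :=
  lie_self f

theorem loopBracket_skew (f h : LieAlgebra.loopAlgebra ℂ ℤ g) :
    loopBracket g f h = -loopBracket g h f :=
  (lie_skew f h).symm

theorem loopBracket_leibniz (f h l : LieAlgebra.loopAlgebra ℂ ℤ g) :
    loopBracket g f (loopBracket g h l) =
      loopBracket g (loopBracket g f h) l + loopBracket g h (loopBracket g f l) :=
  LieRing.leibniz_lie f h l

theorem loop_induction {p : LieAlgebra.loopAlgebra ℂ ℤ g → Prop} (f : LieAlgebra.loopAlgebra ℂ ℤ g)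
    (h0 : p 0) (hadd : ∀ f f', p f → p f' → p (f + f'))
    (hs : ∀ (n : ℤ) (x : g), p (AddMonoidAlgebra.single n (1 : ℂ) ⊗ₜ[ℂ] x)) : p f := by
  rw [← (LieAlgebra.LoopAlgebra.toFinsupp ℂ ℤ g).symm_apply_apply f]
  induction LieAlgebra.LoopAlgebra.toFinsupp ℂ ℤ g f using Finsupp.induction_linear with
  | zero => simpa using h0
  | add a b ha hb => rw [map_add]; exact hadd _ _ ha hb
  | single n x => rw [LieAlgebra.LoopAlgebra.toFinsupp_symm_single]; exact hs n x

theorem vir_induction {p : (ℤ →₀ ℂ) → Prop} (a : ℤ →₀ ℂ)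
    (h0 : p 0) (hadd : ∀ a b, p a → p b → p (a + b)) (hsmul : ∀ (r : ℂ) a, p a → p (r • a))
    (hs : ∀ n : ℤ, p (Finsupp.single n 1)) : p a := by
  induction a using Finsupp.induction_linear with
  | zero => exact h0
  | add a b ha hb => exact hadd _ _ ha hb
  | single n r => simpa using hsmul r _ (hs n)

theorem wittBracket_skew (a b : ℤ →₀ ℂ) : wittBracket a b = -wittBracket b a := by
  induction a using vir_induction with
  | h0 => simp
  | hadd a a' h h' => simp only [map_add, LinearMap.add_apply, h, h', neg_add]
  | hsmul r a h => simp only [map_smul, LinearMap.smul_apply, h, smul_neg]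
  | hs m =>
  induction b using vir_induction with
  | h0 => simp
  | hadd a a' h h' => simp only [map_add, LinearMap.add_apply, h, h', neg_add]
  | hsmul r a h => simp only [map_smul, LinearMap.smul_apply, h, smul_neg]
  | hs n => rw [wittBracket_single, wittBracket_single, add_comm n m, ← neg_smul, neg_sub]

theorem wittBracket_self (a : ℤ →₀ ℂ) : wittBracket a a = 0 :=
  self_eq_neg.mp (wittBracket_skew a a)

theorem virasoroCocycle_skew (a b : ℤ →₀ ℂ) : virasoroCocycle a b = -virasoroCocycle b a := by
  induction a using vir_induction with
  | h0 => simp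
  | hadd a a' h h' => simp only [map_add, LinearMap.add_apply, h, h', neg_add]
  | hsmul r a h => simp only [map_smul, LinearMap.smul_apply, h, smul_neg]
  | hs m =>
  induction b using vir_induction with
  | h0 => simp
  | hadd a a' h h' => simp only [map_add, LinearMap.add_apply, h, h', neg_add]
  | hsmul r a h => simp only [map_smul, LinearMap.smul_apply, h, smul_neg]
  | hs n =>
    rw [virasoroCocycle_single, virasoroCocycle_single, add_comm n m]
    split_ifs with h
    · rw [show n = -m by omega]; push_cast; ring
    · simp

theorem virasoroCocycle_self (a : ℤ →₀ ℂ) : virasoroCocycle a a = 0 :=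
  self_eq_neg.mp (virasoroCocycle_skew a a)

theorem affineCocycle_skew (f h : LieAlgebra.loopAlgebra ℂ ℤ g) :
    affineCocycle g f h = -affineCocycle g h f := by
  induction f using loop_induction with
  | h0 => simp
  | hadd a a' h h' => simp only [map_add, LinearMap.add_apply, h, h', neg_add]
  | hs m x =>
  induction h using loop_induction with
  | h0 => simp
  | hadd a a' h h' => simp only [map_add, LinearMap.add_apply, h, h', neg_add]
  | hs n y =>
    rw [affineCocycle_single, affineCocycle_single, add_comm n m, LieModule.traceForm_comm]
    split_ifs with h
    · rw [show n = -m by omega]; push_cast; ring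
    · simp

theorem affineCocycle_self (f : LieAlgebra.loopAlgebra ℂ ℤ g) : affineCocycle g f f = 0 :=
  self_eq_neg.mp (affineCocycle_skew f f)

theorem wittBracket_leibniz (a b c : ℤ →₀ ℂ) :
    wittBracket a (wittBracket b c) =
      wittBracket (wittBracket a b) c + wittBracket b (wittBracket a c) := by
  induction a using vir_induction with
  | h0 => simp
  | hadd a a' h h' => simp only [map_add, LinearMap.add_apply, h, h']; abel
  | hsmul r a h => simp only [map_smul, LinearMap.smul_apply, h, smul_add]
  | hs m =>
  induction b using vir_induction with
  | h0 => simp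
  | hadd a a' h h' => simp only [map_add, LinearMap.add_apply, h, h']; abel
  | hsmul r a h => simp only [map_smul, LinearMap.smul_apply, h, smul_add]
  | hs n =>
  induction c using vir_induction with
  | h0 => simp
  | hadd a a' h h' => simp only [map_add, h, h']; abel
  | hsmul r a h => simp only [map_smul, h, smul_add]
  | hs k =>
    simp only [wittBracket_single, map_smul, LinearMap.smul_apply, smul_smul]
    rw [← add_assoc m n k, ← add_assoc n m k, add_comm n m, ← add_smul]
    congr 1; push_cast; ring

theorem virasoroCocycle_leibniz (a b c : ℤ →₀ ℂ) :
    virasoroCocycle a (wittBracket b c) =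
      virasoroCocycle (wittBracket a b) c + virasoroCocycle b (wittBracket a c) := by
  induction a using vir_induction with
  | h0 => simp
  | hadd a a' h h' => simp only [map_add, LinearMap.add_apply, h, h']; abel
  | hsmul r a h => simp only [map_smul, LinearMap.smul_apply, h, smul_add]
  | hs m =>
  induction b using vir_induction with
  | h0 => simp
  | hadd a a' h h' => simp only [map_add, LinearMap.add_apply, h, h']; abel
  | hsmul r a h => simp only [map_smul, LinearMap.smul_apply, h, smul_add]
  | hs n =>
  induction c using vir_induction with
  | h0 => simp
  | hadd a a' h h' => simp only [map_add, h, h']; abel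
  | hsmul r a h => simp only [map_smul, h, smul_add]
  | hs k =>
    simp only [wittBracket_single, map_smul, LinearMap.smul_apply, virasoroCocycle_single]
    rw [← add_assoc m n k, ← add_assoc n m k, add_comm n m]
    split_ifs with h
    · rw [show k = -m - n by omega]; simp only [smul_eq_mul]; push_cast; ring
    · simp

theorem wittAction_loopBracket (a : ℤ →₀ ℂ) (f h : LieAlgebra.loopAlgebra ℂ ℤ g) :
    wittAction g a (loopBracket g f h) =
      loopBracket g (wittAction g a f) h + loopBracket g f (wittAction g a h) := by
  induction a using vir_induction with
  | h0 => simp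
  | hadd a a' h h' => simp only [map_add, LinearMap.add_apply, h, h']; abel
  | hsmul r a h => simp only [map_smul, LinearMap.smul_apply, h, smul_add]
  | hs m =>
  induction f using loop_induction with
  | h0 => simp
  | hadd a a' h h' => simp only [map_add, LinearMap.add_apply, h, h']; abel
  | hs n x =>
  induction h using loop_induction with
  | h0 => simp
  | hadd a a' h h' => simp only [map_add, h, h']; abel
  | hs k y =>
    simp only [wittAction_single, map_smul, LinearMap.smul_apply, loopBracket_single]
    rw [← add_assoc m n k, ← add_assoc n m k, add_comm n m, ← add_smul]
    congr 1; push_cast; ring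

theorem wittAction_bracket (a b : ℤ →₀ ℂ) (f : LieAlgebra.loopAlgebra ℂ ℤ g) :
    wittAction g (wittBracket a b) f =
      wittAction g a (wittAction g b f) - wittAction g b (wittAction g a f) := by
  induction a using vir_induction with
  | h0 => simp
  | hadd a a' h h' => simp only [map_add, LinearMap.add_apply, h, h']; abel
  | hsmul r a h => simp only [map_smul, LinearMap.smul_apply, h, smul_sub]
  | hs m =>
  induction b using vir_induction with
  | h0 => simp
  | hadd a a' h h' => simp only [map_add, LinearMap.add_apply, h, h']; abel
  | hsmul r a h => simp only [map_smul, LinearMap.smul_apply, h, smul_sub]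
  | hs n =>
  induction f using loop_induction with
  | h0 => simp
  | hadd a a' h h' => simp only [map_add, h, h']; abel
  | hs k x =>
    simp only [wittBracket_single, wittAction_single, map_smul, LinearMap.smul_apply, smul_smul]
    rw [← add_assoc m n k, ← add_assoc n m k, add_comm n m, ← sub_smul]
    congr 1; push_cast; ring

theorem affineCocycle_wittAction (a : ℤ →₀ ℂ) (f h : LieAlgebra.loopAlgebra ℂ ℤ g) :
    affineCocycle g (wittAction g a f) h + affineCocycle g f (wittAction g a h) = 0 := by
  induction a using vir_induction with
  | h0 => simp
  | hadd a a' h h' =>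
    simp only [map_add, LinearMap.add_apply]
    rw [add_add_add_comm, h, h', add_zero]
  | hsmul r a h =>
    simp only [map_smul, LinearMap.smul_apply]
    rw [← smul_add, h, smul_zero]
  | hs m =>
  induction f using loop_induction with
  | h0 => simp
  | hadd a a' h h' =>
    simp only [map_add, LinearMap.add_apply]
    rw [add_add_add_comm, h, h', add_zero]
  | hs n x =>
  induction h using loop_induction with
  | h0 => simp
  | hadd a a' h h' =>
    simp only [map_add]
    rw [add_add_add_comm, h, h', add_zero]
  | hs k y =>
    simp only [wittAction_single, map_smul, LinearMap.smul_apply, affineCocycle_single]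
    rw [← add_assoc n m k, add_comm n m]
    split_ifs with h
    · rw [show k = -m - n by omega]; simp only [smul_eq_mul]; push_cast; ring
    · simp

theorem affineCocycle_leibniz (f h l : LieAlgebra.loopAlgebra ℂ ℤ g) :
    affineCocycle g f (loopBracket g h l) =
      affineCocycle g (loopBracket g f h) l + affineCocycle g h (loopBracket g f l) := by
  induction f using loop_induction with
  | h0 => simp
  | hadd a a' h h' => simp only [map_add, LinearMap.add_apply, h, h']; abel
  | hs m x =>
  induction h using loop_induction with
  | h0 => simp
  | hadd a a' h h' => simp only [map_add, LinearMap.add_apply, h, h']; abel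
  | hs n y =>
  induction l using loop_induction with
  | h0 => simp
  | hadd a a' h h' => simp only [map_add, h, h']; abel
  | hs k z =>
    have h1 : killingForm ℂ g ⁅x, y⁆ z = killingForm ℂ g x ⁅y, z⁆ :=
      LieModule.traceForm_apply_lie_apply ℂ g g x y z
    have h2 : killingForm ℂ g y ⁅x, z⁆ = -killingForm ℂ g x ⁅y, z⁆ := by
      rw [← h1, ← lie_skew x y, map_neg, LinearMap.neg_apply, neg_neg]
      exact (LieModule.traceForm_apply_lie_apply ℂ g g y x z).symm
    simp only [loopBracket_single, affineCocycle_single]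
    rw [← add_assoc m n k, ← add_assoc n m k, add_comm n m, h1, h2]
    split_ifs with h
    · push_cast; ring
    · simp

end Identities

namespace AffineVirasoro

variable {g : Type*} [LieRing g] [LieAlgebra ℂ g]

/-- The structure is, as a type, a product; its vector space structure is the componentwise one. -/
def toProd (g : Type*) [LieRing g] [LieAlgebra ℂ g] :
    AffineVirasoro g ≃ LieAlgebra.loopAlgebra ℂ ℤ g × ℂ × ℂ × (ℤ →₀ ℂ) where
  toFun X := (X.loop, X.k₁, X.k₂, X.vir)
  invFun p := ⟨p.1, p.2.1, p.2.2.1, p.2.2.2⟩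
  left_inv _ := rfl
  right_inv _ := rfl

instance : AddCommGroup (AffineVirasoro g) := (toProd g).addCommGroup

instance : Module ℂ (AffineVirasoro g) := (toProd g).module ℂ

/-- The Lie bracket of the affine-Virasoro Lie algebra. -/
instance : Bracket (AffineVirasoro g) (AffineVirasoro g) where
  bracket X Y :=
    { loop := loopBracket g X.loop Y.loop + wittAction g X.vir Y.loop - wittAction g Y.vir X.loop
      k₁ := affineCocycle g X.loop Y.loop
      k₂ := virasoroCocycle X.vir Y.vir
      vir := wittBracket X.vir Y.vir }

@[simp] theorem zero_loop : (0 : AffineVirasoro g).loop = 0 := rfl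
@[simp] theorem zero_k₁ : (0 : AffineVirasoro g).k₁ = 0 := rfl
@[simp] theorem zero_k₂ : (0 : AffineVirasoro g).k₂ = 0 := rfl
@[simp] theorem zero_vir : (0 : AffineVirasoro g).vir = 0 := rfl
@[simp] theorem add_loop (X Y : AffineVirasoro g) : (X + Y).loop = X.loop + Y.loop := rfl
@[simp] theorem add_k₁ (X Y : AffineVirasoro g) : (X + Y).k₁ = X.k₁ + Y.k₁ := rfl
@[simp] theorem add_k₂ (X Y : AffineVirasoro g) : (X + Y).k₂ = X.k₂ + Y.k₂ := rfl
@[simp] theorem add_vir (X Y : AffineVirasoro g) : (X + Y).vir = X.vir + Y.vir := rfl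
@[simp] theorem smul_loop (r : ℂ) (X : AffineVirasoro g) : (r • X).loop = r • X.loop := rfl
@[simp] theorem smul_k₁ (r : ℂ) (X : AffineVirasoro g) : (r • X).k₁ = r • X.k₁ := rfl
@[simp] theorem smul_k₂ (r : ℂ) (X : AffineVirasoro g) : (r • X).k₂ = r • X.k₂ := rfl
@[simp] theorem smul_vir (r : ℂ) (X : AffineVirasoro g) : (r • X).vir = r • X.vir := rfl
@[simp] theorem lie_loop (X Y : AffineVirasoro g) : ⁅X, Y⁆.loop =
    loopBracket g X.loop Y.loop + wittAction g X.vir Y.loop - wittAction g Y.vir X.loop := rfl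
@[simp] theorem lie_k₁ (X Y : AffineVirasoro g) :
    ⁅X, Y⁆.k₁ = affineCocycle g X.loop Y.loop := rfl
@[simp] theorem lie_k₂ (X Y : AffineVirasoro g) :
    ⁅X, Y⁆.k₂ = virasoroCocycle X.vir Y.vir := rfl
@[simp] theorem lie_vir (X Y : AffineVirasoro g) :
    ⁅X, Y⁆.vir = wittBracket X.vir Y.vir := rfl

instance : LieRing (AffineVirasoro g) where
  add_lie X Y Z := by
    ext1 <;> simp
    abel
  lie_add X Y Z := by
    ext1 <;> simp
    abel
  lie_self X := by
    ext1 <;> simp [loopBracket_self, wittBracket_self, virasoroCocycle_self, affineCocycle_self]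
  leibniz_lie X Y Z := by
    ext1
    · simp only [lie_loop, lie_vir, add_loop, map_add, map_sub, wittAction_loopBracket,
        wittAction_bracket, LinearMap.add_apply, LinearMap.sub_apply,
        loopBracket_leibniz X.loop Y.loop Z.loop]
      rw [loopBracket_skew (wittAction g Z.vir X.loop) Y.loop]
      abel
    · have h1 := affineCocycle_wittAction Y.vir X.loop Z.loop
      have h2 := affineCocycle_wittAction Z.vir X.loop Y.loop
      have h3 := affineCocycle_wittAction X.vir Y.loop Z.loop
      have h4 := affineCocycle_skew (wittAction g Z.vir X.loop) Y.loop
      simp only [lie_k₁, lie_loop, add_k₁, map_add, map_sub, LinearMap.add_apply,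
        LinearMap.sub_apply, affineCocycle_leibniz X.loop Y.loop Z.loop]
      linear_combination h1 - h2 - h3 + h4
    · simp [virasoroCocycle_leibniz X.vir Y.vir Z.vir]
    · simp [wittBracket_leibniz X.vir Y.vir Z.vir]

instance : LieAlgebra ℂ (AffineVirasoro g) where
  lie_smul r X Y := by
    ext1 <;> simp [smul_sub, smul_add]

/-- The element `x ⊗ t ^ n`. -/
def tensor (x : g) (n : ℤ) : AffineVirasoro g :=
  ⟨AddMonoidAlgebra.single n 1 ⊗ₜ[ℂ] x, 0, 0, 0⟩

/-- The element `d_n`. -/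
def d (g : Type*) [LieRing g] [LieAlgebra ℂ g] (n : ℤ) : AffineVirasoro g :=
  ⟨0, 0, 0, Finsupp.single n 1⟩

/-- The central element `K₁`. -/
def K₁ (g : Type*) [LieRing g] [LieAlgebra ℂ g] : AffineVirasoro g := ⟨0, 1, 0, 0⟩

/-- The central element `K₂`. -/
def K₂ (g : Type*) [LieRing g] [LieAlgebra ℂ g] : AffineVirasoro g := ⟨0, 0, 1, 0⟩

/-! The defining brackets of the affine-Virasoro Lie algebra. -/

theorem lie_tensor_tensor (x y : g) (m n : ℤ) :
    ⁅tensor x m, tensor y n⁆ =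
      tensor ⁅x, y⁆ (m + n) + (if m + n = 0 then (m : ℂ) * killingForm ℂ g x y else 0) • K₁ g := by
  ext1 <;> simp only [tensor, K₁, lie_loop, lie_k₁, lie_k₂, lie_vir, add_loop, add_k₁, add_k₂,
    add_vir, smul_loop, smul_k₁, smul_k₂, smul_vir, loopBracket_single, affineCocycle_single] <;>
    simp

theorem lie_K₁ (X : AffineVirasoro g) : ⁅X, K₁ g⁆ = 0 := by
  ext1 <;> simp [K₁]

theorem lie_K₂ (X : AffineVirasoro g) : ⁅X, K₂ g⁆ = 0 := by
  ext1 <;> simp [K₂]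

theorem lie_d_tensor (x : g) (m n : ℤ) :
    ⁅d g m, tensor x n⁆ = (n : ℂ) • tensor x (m + n) := by
  ext1 <;> simp only [d, tensor, lie_loop, lie_k₁, lie_k₂, lie_vir, smul_loop, smul_k₁, smul_k₂,
    smul_vir, wittAction_single] <;> simp

theorem lie_d_d (m n : ℤ) :
    ⁅d g m, d g n⁆ = ((n : ℂ) - m) • d g (m + n) +
      (if m + n = 0 then ((m : ℂ) ^ 3 - m) / 12 else 0) • K₂ g := by
  ext1 <;> simp only [d, K₂, lie_loop, lie_k₁, lie_k₂, lie_vir, add_loop, add_k₁, add_k₂, add_vir,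
    smul_loop, smul_k₁, smul_k₂, smul_vir, wittBracket_single, virasoroCocycle_single] <;> simp

end AffineVirasoro

/-- A bilinear map `F : L × L → V` from a Lie algebra `L` to an `L`-module `V` is a biderivation if
it is a derivation in each argument. -/
structure IsBiderivation {R L V : Type*} [CommRing R] [LieRing L] [LieAlgebra R L] [AddCommGroup V]
    [Module R V] [LieRingModule L V] [LieModule R L V] (F : L →ₗ[R] L →ₗ[R] V) : Prop where
  lie_left : ∀ x y z : L, F ⁅x, y⁆ z = ⁅x, F y z⁆ - ⁅y, F x z⁆
  lie_right : ∀ x y z : L, F x ⁅y, z⁆ = ⁅y, F x z⁆ - ⁅z, F x y⁆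

/-- A bilinear map on a Lie algebra `L` is an inner biderivation if it is a scalar multiple of the
Lie bracket. -/
def IsInnerBiderivation {R L : Type*} [CommRing R] [LieRing L] [LieAlgebra R L]
    (F : L →ₗ[R] L →ₗ[R] L) : Prop :=
  ∃ c : R, ∀ x y : L, F x y = c • ⁅x, y⁆

end

/-! Let `L` be the affine-Virasoro algebra, graded by the eigenvalues of `ad d_0`, and work modulo
the centre, where the degree `j` part is `g × ℂ`. Expanding `F ([d_0, X], Y)` for `X` of degree `m`
gives `(j - m) F(X, Y)_j = -[F(d_0, Y)_(j - m), X]` (`sub_smul_component_biderivation`), and the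
same holds in the other argument. So `F` is nearly determined by its values at `d_0`, and at `j = m`
the identity becomes a constraint on `F(d_0, Y)_0`.

Since `[d_0, d_1] = d_1`, the only possible scalar is the `d_1` coefficient `c` of `F(d_0, d_1)`.
Replacing `F` by `F - c [·, ·]`, assume `c = 0`. These identities give first `F(d_0, d_0) = 0`,
hence `F(d_0, ·)` preserves degree. Comparing the two formulas for `F(X, Y)` in degree `m + n` then
forces `F(d_0, ·) = 0` (`component_biderivation_d_zero`). The remaining components vanish because
`F(X, Y)` would need the degrees of both `X` and `Y`; coincident or zero degrees are avoided by
writing elements as brackets (`component_biderivation_eq_zero`).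

Thus `F` takes central values. The rule for `F(X, [Y, Z])` then shows that `F(X, ·)` kills all
brackets, and `L` is perfect (`map_eq_zero_of_map_lie_eq_zero`), so `F = 0` exactly and not only
modulo the centre. -/

noncomputable section

open scoped TensorProduct

/-! ### The grading modulo the centre. -/

namespace AffineVirasoro

variable {g : Type*} [LieRing g] [LieAlgebra ℂ g]

/-- The homogeneous component of degree `j`, modulo the centre: the pair `(x, c)` stands for
`x ⊗ t ^ j + c d_j`. -/
def component (g : Type*) [LieRing g] [LieAlgebra ℂ g] (j : ℤ) :
    AffineVirasoro g →ₗ[ℂ] g × ℂ where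
  toFun X := (LieAlgebra.LoopAlgebra.toFinsupp ℂ ℤ g X.loop j, X.vir j)
  map_add' X Y := by simp
  map_smul' r X := by simp

theorem tensor_add (x y : g) (n : ℤ) : tensor (x + y) n = tensor x n + tensor y n := by
  ext1 <;> simp [tensor, TensorProduct.tmul_add]

theorem tensor_smul (r : ℂ) (x : g) (n : ℤ) : tensor (r • x) n = r • tensor x n := by
  ext1 <;> simp [tensor]

/-- The homogeneous element `x ⊗ t ^ n + c d_n` attached to the pair `(x, c)`. -/
def homogeneous (g : Type*) [LieRing g] [LieAlgebra ℂ g] (n : ℤ) :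
    g × ℂ →ₗ[ℂ] AffineVirasoro g where
  toFun p := tensor p.1 n + p.2 • d g n
  map_add' p q := by
    ext1 <;> simp [tensor, d, TensorProduct.tmul_add]
  map_smul' r p := by
    ext1 <;> simp [tensor, d]

/-- The bracket of homogeneous elements of degrees `m` and `n`, modulo the centre. -/
def gradedBracket (m n : ℂ) (p q : g × ℂ) : g × ℂ :=
  (⁅p.1, q.1⁆ + (p.2 * n) • q.1 - (q.2 * m) • p.1, p.2 * q.2 * (n - m))

theorem homogeneous_apply (n : ℤ) (p : g × ℂ) :
    homogeneous g n p = tensor p.1 n + p.2 • d g n := rfl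

theorem homogeneous_zero_one (n : ℤ) : homogeneous g n (0, 1) = d g n := by
  ext1 <;> simp [homogeneous_apply, tensor, d]

theorem component_K₁ (j : ℤ) : component g j (K₁ g) = 0 := by
  simp [component, K₁]

theorem component_K₂ (j : ℤ) : component g j (K₂ g) = 0 := by
  simp [component, K₂]

theorem component_homogeneous (j n : ℤ) (p : g × ℂ) :
    component g j (homogeneous g n p) = if n = j then p else 0 := by
  have h1 : (component g j (homogeneous g n p)).1 = Finsupp.single n p.1 j := by
    rw [← LieAlgebra.LoopAlgebra.toFinsupp_single_tmul (R := ℂ)]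
    simp [component, homogeneous_apply, tensor, d]
  have h2 : (component g j (homogeneous g n p)).2 = Finsupp.single n p.2 j := by
    simp [component, homogeneous_apply, tensor, d]
  rw [Finsupp.single_apply] at h1 h2
  ext
  · rw [h1]; split_ifs <;> rfl
  · rw [h2]; split_ifs <;> rfl

theorem component_homogeneous_self (n : ℤ) (p : g × ℂ) :
    component g n (homogeneous g n p) = p := by
  simp [component_homogeneous]

theorem eq_of_component_eq_zero {X : AffineVirasoro g} (h : ∀ j, component g j X = 0) :
    X.loop = 0 ∧ X.vir = 0 := by
  refine ⟨(LieAlgebra.LoopAlgebra.toFinsupp ℂ ℤ g).map_eq_zero_iff.1 ?_, ?_⟩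
  · ext j; exact congrArg Prod.fst (h j)
  · ext j; exact congrArg Prod.snd (h j)

theorem lie_eq_zero_of_component_eq_zero {X : AffineVirasoro g} (h : ∀ j, component g j X = 0)
    (Y : AffineVirasoro g) : ⁅Y, X⁆ = 0 := by
  obtain ⟨h1, h2⟩ := eq_of_component_eq_zero h
  ext1 <;> simp [h1, h2]

/-- No closure under scalars is needed: homogeneous pieces and central elements already absorb them.
-/
theorem homogeneous_induction {P : AffineVirasoro g → Prop} (X : AffineVirasoro g)
    (hadd : ∀ X Y, P X → P Y → P (X + Y))
    (hcentral : ∀ X, (∀ j, component g j X = 0) → P X)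
    (hhom : ∀ n p, P (homogeneous g n p)) : P X := by
  have h1 (f : LieAlgebra.loopAlgebra ℂ ℤ g) : P ⟨f, 0, 0, 0⟩ := by
    induction f using loop_induction with
    | h0 => exact hcentral _ fun j => by simp [component]
    | hadd a b ha hb =>
      convert hadd _ _ ha hb using 1
      ext1 <;> simp
    | hs n x =>
      convert hhom n (x, 0) using 1
      ext1 <;> simp [homogeneous_apply, tensor, d]
  have h2 (a : ℤ →₀ ℂ) : P ⟨0, 0, 0, a⟩ := by
    induction a using Finsupp.induction_linear with
    | zero => exact hcentral _ fun j => by simp [component]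
    | add a b ha hb =>
      convert hadd _ _ ha hb using 1
      ext1 <;> simp
    | single n r =>
      convert hhom n (0, r) using 1
      ext1 <;> simp [homogeneous_apply, tensor, d]
  have h3 : P ⟨0, X.k₁, X.k₂, 0⟩ := hcentral _ fun j => by simp [component]
  convert hadd _ _ (hadd _ _ (h1 X.loop) (h2 X.vir)) h3 using 1
  ext1 <;> simp

theorem component_lie_homogeneous_homogeneous (j m n : ℤ) (p q : g × ℂ) :
    component g j ⁅homogeneous g m p, homogeneous g n q⁆ =
      component g j (homogeneous g (m + n) (gradedBracket m n p q)) := by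
  have h : ⁅tensor p.1 m, d g n⁆ = -((m : ℂ) • tensor p.1 (n + m)) := by
    rw [← lie_skew, lie_d_tensor]
  simp only [homogeneous_apply, add_lie, lie_add, smul_lie, lie_smul, lie_tensor_tensor,
    lie_d_tensor, lie_d_d, h, map_add, map_smul, map_neg, component_K₁, component_K₂, smul_zero,
    add_zero, gradedBracket]
  rw [sub_eq_add_neg _ ((q.2 * (m : ℂ)) • p.1), ← neg_smul (q.2 * (m : ℂ)) p.1]
  simp only [tensor_add, tensor_smul]
  rw [add_comm n m]
  simp only [map_add, map_smul]
  module

theorem component_lie_homogeneous (j n : ℤ) (X : AffineVirasoro g) (q : g × ℂ) :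
    component g j ⁅X, homogeneous g n q⁆ =
      gradedBracket ((j - n : ℤ) : ℂ) n (component g (j - n) X) q := by
  induction X using homogeneous_induction with
  | hadd X Y hX hY =>
    rw [add_lie, map_add, map_add, hX, hY]
    ext
    · simp only [gradedBracket, Prod.fst_add, Prod.snd_add, add_lie]
      module
    · simp only [gradedBracket, Prod.snd_add]
      ring
  | hcentral X hX =>
    rw [← lie_skew, lie_eq_zero_of_component_eq_zero hX, hX]
    ext <;> simp [gradedBracket]
  | hhom m p =>
    rw [component_lie_homogeneous_homogeneous, component_homogeneous, component_homogeneous]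
    by_cases h : m + n = j
    · obtain rfl : m = j - n := by omega
      simp
    · rw [if_neg h, if_neg (by omega)]
      ext <;> simp [gradedBracket]

theorem component_lie_d_zero (j : ℤ) (X : AffineVirasoro g) :
    component g j ⁅d g 0, X⁆ = (j : ℂ) • component g j X := by
  rw [← lie_skew, map_neg, ← homogeneous_zero_one, component_lie_homogeneous]
  ext <;> simp [gradedBracket, mul_comm]

theorem lie_d_zero_homogeneous (n : ℤ) (p : g × ℂ) :
    ⁅d g 0, homogeneous g n p⁆ = (n : ℂ) • homogeneous g n p := by
  simp only [homogeneous_apply, lie_add, lie_smul, lie_d_tensor, lie_d_d, zero_add]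
  have : (if n = 0 then (((0 : ℤ) : ℂ) ^ 3 - ((0 : ℤ) : ℂ)) / 12 else 0) = 0 := by simp
  rw [this]
  simp only [Int.cast_zero, sub_zero]
  module

end AffineVirasoro

/-! ### Simple Lie algebras: trivial centre, perfectness, nonzero Killing form. -/

section Simple

variable {g : Type*} [LieRing g] [LieAlgebra ℂ g] [LieAlgebra.IsSimple ℂ g]

theorem eq_zero_of_forall_lie_eq_zero {a : g} (h : ∀ b : g, ⁅a, b⁆ = 0) : a = 0 := by
  have h1 : a ∈ LieAlgebra.center ℂ g := by
    rw [LieModule.mem_maxTrivSubmodule]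
    intro b
    rw [← lie_skew, h, neg_zero]
  rwa [LieAlgebra.center_eq_bot, LieSubmodule.mem_bot] at h1

/-- Perfectness in dual form: `[g, g]` is a nonzero ideal, hence all of `g`. -/
theorem map_eq_zero_of_map_lie_eq_zero {V : Type*} [AddCommGroup V] [Module ℂ V] (f : g →ₗ[ℂ] V)
    (h : ∀ a b : g, f ⁅a, b⁆ = 0) : f = 0 := by
  ext x
  have hx : x ∈ (⁅(⊤ : LieIdeal ℂ g), (⊤ : LieIdeal ℂ g)⁆ : LieIdeal ℂ g) := by
    have hne : (⁅(⊤ : LieIdeal ℂ g), (⊤ : LieIdeal ℂ g)⁆ : LieIdeal ℂ g) ≠ ⊥ := by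
      intro hbot
      refine LieAlgebra.IsSimple.non_abelian (R := ℂ) (L := g) ⟨fun a b => ?_⟩
      have := LieSubmodule.lie_mem_lie (LieSubmodule.mem_top (R := ℂ) (L := g) a)
        (LieSubmodule.mem_top (R := ℂ) (L := g) b)
      rwa [hbot, LieSubmodule.mem_bot] at this
    rw [(LieAlgebra.IsSimple.eq_bot_or_eq_top _).resolve_left hne]
    exact LieSubmodule.mem_top x
  rw [← LieSubmodule.mem_toSubmodule, LieSubmodule.lieIdeal_oper_eq_linear_span'] at hx
  refine Submodule.span_le (p := LinearMap.ker f).2 ?_ hx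
  rintro _ ⟨a, -, b, -, rfl⟩
  exact h a b

theorem exists_killingForm_ne_zero [FiniteDimensional ℂ g] :
    ∃ x y : g, killingForm ℂ g x y ≠ 0 := by
  by_contra! h
  refine LieAlgebra.IsSimple.non_abelian (R := ℂ) (L := g) ⟨fun a b => ?_⟩
  have h0 : ⁅a, b⁆ ∈ LinearMap.ker (killingForm ℂ g) := by
    ext y
    exact h _ y
  rwa [LieAlgebra.IsKilling.ker_killingForm_eq_bot] at h0

end Simple

/-! ### Perfectness and centre of the affine-Virasoro algebra. -/

namespace AffineVirasoro

variable {g : Type*} [LieRing g] [LieAlgebra ℂ g] [LieAlgebra.IsSimple ℂ g]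

/-- Perfectness in dual form, checked on generators; in particular both central elements are
combinations of brackets. -/
theorem map_eq_zero_of_map_lie_eq_zero [FiniteDimensional ℂ g] {V : Type*} [AddCommGroup V]
    [Module ℂ V] (f : AffineVirasoro g →ₗ[ℂ] V) (h : ∀ X Y : AffineVirasoro g, f ⁅X, Y⁆ = 0)
    (X : AffineVirasoro g) : f X = 0 := by
  have ht (n : ℤ) (x : g) : f (tensor x n) = 0 := by
    have := _root_.map_eq_zero_of_map_lie_eq_zero
      (f ∘ₗ homogeneous g n ∘ₗ LinearMap.inl ℂ g ℂ) fun a b => by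
        -- Degree 0 in the first factor removes the `K₁` term.
        have := h (tensor a 0) (tensor b n)
        rw [lie_tensor_tensor] at this
        simpa [homogeneous_apply] using this
    simpa [homogeneous_apply] using LinearMap.congr_fun this x
  have hd (n : ℤ) : f (d g n) = 0 := by
    by_cases hn : n = 0
    · have := h (d g 1) (d g (-1))
      rw [lie_d_d] at this
      subst hn
      norm_num at this
      exact this
    · have := h (d g 0) (d g n)
      rw [lie_d_d, zero_add, if_neg hn] at this
      simpa [hn] using this
  have h₁ : f (K₁ g) = 0 := by
    obtain ⟨x, y, hxy⟩ := exists_killingForm_ne_zero (g := g)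
    have := h (tensor x 1) (tensor y (-1))
    rw [lie_tensor_tensor, map_add, ht] at this
    simpa [hxy] using this
  have h₂ : f (K₂ g) = 0 := by
    -- The cocycle vanishes on `d_1, d_(-1)`, so 2 is the first degree that reaches `K₂`.
    have := h (d g 2) (d g (-2))
    rw [lie_d_d, map_add, map_smul, hd] at this
    norm_num at this
    exact this
  induction X using homogeneous_induction with
  | hadd X Y hX hY => rw [map_add, hX, hY, add_zero]
  | hcentral X hX =>
    obtain ⟨hl, hv⟩ := eq_of_component_eq_zero hX
    have : X = X.k₁ • K₁ g + X.k₂ • K₂ g := by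
      ext1 <;> simp [hl, hv, K₁, K₂]
    rw [this, map_add, map_smul, map_smul, h₁, h₂, smul_zero, smul_zero, add_zero]
  | hhom n p => rw [homogeneous_apply, map_add, map_smul, ht, hd, smul_zero, add_zero]

/-- Testing against `d_n` kills the `d_m` coefficient, which needs `n ≠ m`; testing against `g` then
leaves an element of the trivial centre of `g`. -/
theorem eq_zero_of_gradedBracket_eq_zero {m n : ℂ} (hmn : n ≠ m) {p : g × ℂ}
    (h : ∀ q, gradedBracket m n p q = 0) : p = 0 := by
  have h2 : p.2 = 0 := by
    simpa [gradedBracket, sub_eq_zero, hmn] using congrArg Prod.snd (h (0, 1))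
  refine Prod.ext (eq_zero_of_forall_lie_eq_zero fun b => ?_) h2
  simpa [gradedBracket, h2] using congrArg Prod.fst (h (b, 0))

theorem component_eq_zero_of_lie_eq_zero {X : AffineVirasoro g}
    (h : ∀ Y : AffineVirasoro g, ⁅Y, X⁆ = 0) (j : ℤ) :
    component g j X = 0 := by
  -- Any test degree other than `j` would do.
  refine eq_zero_of_gradedBracket_eq_zero (m := j) (n := (j + 1 : ℤ)) (by simp) fun q => ?_
  have := component_lie_homogeneous (2 * j + 1) (j + 1) X q
  rw [← lie_skew, h, neg_zero, map_zero, show 2 * j + 1 - (j + 1) = j by ring] at this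
  exact this.symm

end AffineVirasoro

/-! ### Operations on biderivations. -/

namespace IsBiderivation

variable {R L V : Type*} [CommRing R] [LieRing L] [LieAlgebra R L] [AddCommGroup V] [Module R V]
  [LieRingModule L V] [LieModule R L V] {F : L →ₗ[R] L →ₗ[R] V}

/-- Transfers every result on the first argument to the second. -/
theorem flip (hF : IsBiderivation F) : IsBiderivation F.flip where
  lie_left x y z := hF.lie_right z x y
  lie_right x y z := hF.lie_left y z x

theorem sub_smul_lie {F : L →ₗ[R] L →ₗ[R] L} (hF : IsBiderivation F) (c : R) :
    IsBiderivation (F - c • lieBilinear R L) where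
  lie_left x y z := by
    simp only [LinearMap.sub_apply, LinearMap.smul_apply, lieBilinear, LinearMap.mk₂_apply,
      hF.lie_left, lie_sub, lie_smul, lie_lie, smul_sub]
    abel
  lie_right x y z := by
    simp only [LinearMap.sub_apply, LinearMap.smul_apply, lieBilinear, LinearMap.mk₂_apply,
      hF.lie_right, lie_sub, lie_smul, leibniz_lie x y z, ← lie_skew z ⁅x, y⁆, smul_add, smul_neg]
    abel

end IsBiderivation

/-! ### Values of a biderivation at `d_0`. -/

namespace AffineVirasoro

variable {g : Type*} [LieRing g] [LieAlgebra ℂ g]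
  {F : AffineVirasoro g →ₗ[ℂ] AffineVirasoro g →ₗ[ℂ] AffineVirasoro g}

/-- Degree `j` of the derivation rule for `F ([d_0, X], Y)`, with `X` of degree `m`: one term
contributes the eigenvalue `m`, another `j`. For `j = m` the left side disappears and the right side
becomes a constraint. -/
theorem sub_smul_component_biderivation (hF : IsBiderivation F) (j m : ℤ) (p : g × ℂ)
    (Y : AffineVirasoro g) :
    ((j : ℂ) - m) • component g j (F (homogeneous g m p) Y) =
      -gradedBracket ((j - m : ℤ) : ℂ) m (component g (j - m) (F (d g 0) Y)) p := by
  have h := congrArg (component g j) (hF.lie_left (d g 0) (homogeneous g m p) Y)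
  rw [lie_d_zero_homogeneous, map_sub, component_lie_d_zero, ← lie_skew, map_neg,
    component_lie_homogeneous, map_smul, LinearMap.smul_apply, map_smul, sub_neg_eq_add] at h
  rw [sub_smul, h]
  abel

theorem gradedBracket_zero_left (m n : ℂ) (q : g × ℂ) : gradedBracket m n 0 q = 0 := by
  ext <;> simp [gradedBracket]

/-- Both ways of computing `F (d_0, d_0)` modulo the centre from the derivation rules agree only
if it vanishes. -/
theorem component_biderivation_d_zero_d_zero [LieAlgebra.IsSimple ℂ g] (hF : IsBiderivation F)
    (k : ℤ) : component g k (F (d g 0) (d g 0)) = 0 := by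
  set w := component g k (F (d g 0) (d g 0)) with hw
  have hr (n : ℤ) (q : g × ℂ) :
      (k : ℂ) • component g (n + k) (F (d g 0) (homogeneous g n q)) = -gradedBracket k n w q := by
    have := sub_smul_component_biderivation hF.flip (n + k) n q (d g 0)
    simpa [← hw] using this
  have hl (m : ℤ) (p : g × ℂ) :
      (k : ℂ) • component g (m + k) (F (homogeneous g m p) (d g 0)) = -gradedBracket k m w p := by
    have := sub_smul_component_biderivation hF (m + k) m p (d g 0)
    simpa [← hw] using this
  by_cases hk : k = 0
  · refine eq_zero_of_gradedBracket_eq_zero (m := k) (n := (k + 1 : ℤ)) (by simp) fun q => ?_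
    have := hr (k + 1) q
    rw [show (k : ℂ) = 0 by simp [hk], zero_smul] at this
    rw [show (k : ℂ) = 0 by simp [hk]]
    exact neg_eq_zero.1 this.symm
  · have hk' : (k : ℂ) ≠ 0 := by exact_mod_cast hk
    -- For `Y` of degree `-k`, `-[w, Y]` is `k` times the degree 0 part of `F (d_0, Y)`. The
    -- constraint `j = m = k` says that this part commutes with everything of degree `k ≠ 0`, so it
    -- vanishes.
    have h0 (q : g × ℂ) : gradedBracket k ((-k : ℤ) : ℂ) w q = 0 := by
      rw [← neg_eq_zero, ← hr, smul_eq_zero_iff_right hk']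
      refine eq_zero_of_gradedBracket_eq_zero (m := ((k - k : ℤ) : ℂ)) (n := k) (by simpa)
        fun p => ?_
      have h1 := sub_smul_component_biderivation hF k k p (homogeneous g (-k) q)
      rw [sub_self, zero_smul] at h1
      rw [show -k + k = k - k by ring]
      exact neg_eq_zero.1 h1.symm
    exact eq_zero_of_gradedBracket_eq_zero (m := k) (n := ((-k : ℤ) : ℂ))
      (fun h => hk (by have : -k = k := by exact_mod_cast h
                       omega)) h0

theorem component_biderivation_d_zero_of_ne [LieAlgebra.IsSimple ℂ g] (hF : IsBiderivation F)
    {j n : ℤ} (hj : j ≠ n) (q : g × ℂ) :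
    component g j (F (d g 0) (homogeneous g n q)) = 0 := by
  have := sub_smul_component_biderivation hF.flip j n q (d g 0)
  rw [LinearMap.flip_apply, LinearMap.flip_apply, component_biderivation_d_zero_d_zero hF,
    gradedBracket_zero_left, neg_zero] at this
  refine (smul_eq_zero.1 this).resolve_left (sub_ne_zero.2 ?_)
  exact_mod_cast hj

/-- The degree `m + n` part of `F (X, Y)` is computed from either argument; the factors `n` and `m`
are cleared by cross-multiplication. -/
theorem smul_gradedBracket_component_biderivation (hF : IsBiderivation F) (m n : ℤ)
    (p q : g × ℂ) :
    (m : ℂ) • gradedBracket n m (component g n (F (d g 0) (homogeneous g n q))) p =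
      (n : ℂ) • gradedBracket m n (component g m (F (homogeneous g m p) (d g 0))) q := by
  have h1 := sub_smul_component_biderivation hF (m + n) m p (homogeneous g n q)
  have h2 := sub_smul_component_biderivation hF.flip (m + n) n q (homogeneous g m p)
  simp only [LinearMap.flip_apply, add_sub_cancel_left, add_sub_cancel_right, Int.cast_add] at h1 h2
  rw [← neg_inj, ← smul_neg, ← smul_neg, ← h1, ← h2, smul_comm]

/-- A biderivation `F` for which `F (d_0, d_1)` has no `d_1` component satisfies
`F (d_0, X) = 0` for all `X`, modulo the centre. -/
theorem component_biderivation_d_zero [LieAlgebra.IsSimple ℂ g] (hF : IsBiderivation F)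
    (h : (component g 1 (F (d g 0) (d g 1))).2 = 0) (n : ℤ) (q : g × ℂ) :
    component g n (F (d g 0) (homogeneous g n q)) = 0 := by
  have key := smul_gradedBracket_component_biderivation hF
  by_cases hn : n = 0
  · subst hn
    refine eq_zero_of_gradedBracket_eq_zero (m := ((0 : ℤ) : ℂ)) (n := ((1 : ℤ) : ℂ)) (by simp)
      fun p => ?_
    -- With `n = 0` the right side of `key` is zero.
    simpa using key 1 0 p q
  -- Specialising the left argument to `d_m` suffices; `k1` and `k2` are the `g` and `d` parts of
  -- the result.
  have keyd (m n : ℤ) (q : g × ℂ) := key m n (0, 1) q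
  set D : ℤ → g × ℂ → g × ℂ := fun n q => component g n (F (d g 0) (homogeneous g n q)) with hD
  set E : ℤ → g × ℂ := fun m => component g m (F (homogeneous g m (0, 1)) (d g 0)) with hE
  have k1 (m n : ℤ) (q : g × ℂ) :
      -((m : ℂ) * n) • (D n q).1 =
        (n : ℂ) • (⁅(E m).1, q.1⁆ + ((E m).2 * n) • q.1 - (q.2 * m) • (E m).1) := by
    have := congrArg Prod.fst (keyd m n q)
    simp only [gradedBracket, Prod.smul_fst, lie_zero, smul_zero, add_zero, one_mul] at this
    rw [← this]
    module
  have k2 (m n : ℤ) (q : g × ℂ) :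
      (m : ℂ) * ((D n q).2 * (m - n)) = n * ((E m).2 * q.2 * (n - m)) := by
    have := congrArg Prod.snd (keyd m n q)
    simpa [gradedBracket] using this
  have hE2 (m : ℤ) (hm : m ≠ 1) : (E m).2 = 0 := by
    have := k2 m 1 (0, 1)
    have h' : (D 1 (0, 1)).2 = 0 := by simpa [hD, homogeneous_zero_one] using h
    have hm' : (1 : ℂ) - m ≠ 0 := by
      rw [sub_ne_zero]; exact_mod_cast hm.symm
    simpa [h', hm'] using this
  have hD2 (n : ℤ) (q : g × ℂ) : (D n q).2 = 0 := by
    -- `m` avoids 1 so that `hE2` applies, and 0 and `n` so that the factor `m (m - n)` cancels.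
    obtain ⟨m, hm0, hm1, hmn⟩ : ∃ m : ℤ, m ≠ 0 ∧ m ≠ 1 ∧ m ≠ n := by
      by_cases h2 : n = 2
      · exact ⟨3, by omega, by omega, by omega⟩
      · exact ⟨2, by omega, by omega, by omega⟩
    have := k2 m n q
    have hm' : (m : ℂ) - n ≠ 0 := by
      rw [sub_ne_zero]; exact_mod_cast hmn
    have hm0' : (m : ℂ) ≠ 0 := by exact_mod_cast hm0
    simpa [hE2 m hm1, hm', hm0'] using this
  have hE1 (m n : ℤ) (hm : m ≠ 0) (hn : n ≠ 0) : (E m).1 = (D n (0, 1)).1 := by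
    have := k1 m n (0, 1)
    have hmn : -((m : ℂ) * n) ≠ 0 := by
      rw [neg_ne_zero]
      exact mul_ne_zero (by exact_mod_cast hm) (by exact_mod_cast hn)
    refine smul_right_injective g hmn ?_
    simp only [this, lie_zero, smul_zero, zero_add]
    module
  -- By `hE1` all the `g` parts of `E m` with `m ≠ 0` agree, so the right side does not depend on
  -- `m`; comparing `m = 2` with `m = 3` then kills both sides.
  have hlie (m n : ℤ) (hm : m ≠ 0) (hm1 : m ≠ 1) (hn : n ≠ 0) (b : g) :
      (m : ℂ) • (D n (b, 0)).1 = -⁅(E 1).1, b⁆ := by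
    have := k1 m n (b, 0)
    rw [hE2 m hm1, hE1 m 1 hm one_ne_zero, ← hE1 1 1 one_ne_zero one_ne_zero] at this
    refine smul_right_injective g (r := -(n : ℂ)) (neg_ne_zero.2 (by exact_mod_cast hn)) ?_
    simp only [zero_mul, zero_smul, add_zero, sub_zero] at this
    calc -(n : ℂ) • (m : ℂ) • (D n (b, 0)).1 = -((m : ℂ) * n) • (D n (b, 0)).1 := by module
      _ = (n : ℂ) • ⁅(E 1).1, b⁆ := this
      _ = -(n : ℂ) • -⁅(E 1).1, b⁆ := by module
  have hDb (n : ℤ) (hn : n ≠ 0) (b : g) : (D n (b, 0)).1 = 0 := by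
    have h2 := hlie 2 n (by omega) (by omega) hn b
    have h3 := hlie 3 n (by omega) (by omega) hn b
    have : (D n (b, 0)).1 = ((3 : ℤ) : ℂ) • (D n (b, 0)).1 - ((2 : ℤ) : ℂ) • (D n (b, 0)).1 := by
      push_cast
      module
    rw [this, h2, h3, sub_self]
  have hE0 : (E 1).1 = 0 := eq_zero_of_forall_lie_eq_zero fun b => by
    rw [← neg_eq_zero, ← hlie 2 1 (by omega) (by omega) one_ne_zero b, hDb 1 one_ne_zero, smul_zero]
  have hsplit : D n q = D n (q.1, 0) + q.2 • D n (0, 1) := by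
    simp only [hD, ← map_smul, ← map_add]
    simp
  refine Prod.ext ?_ (hD2 n q)
  change (D n q).1 = 0
  rw [hsplit, Prod.fst_add, Prod.smul_fst, hDb n hn, ← hE1 1 n one_ne_zero hn, hE0, smul_zero,
    add_zero]

/-! ### From `d_0` to all arguments. -/

/-- For central `Z`, expanding `F ([Z, X], Y) = 0` leaves `[X, F (Z, Y)] = 0` for all `X`. -/
theorem component_biderivation_of_component_eq_zero_left [LieAlgebra.IsSimple ℂ g]
    (hF : IsBiderivation F) {Z : AffineVirasoro g} (hZ : ∀ j, component g j Z = 0)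
    (Y : AffineVirasoro g) (j : ℤ) : component g j (F Z Y) = 0 := by
  refine component_eq_zero_of_lie_eq_zero (fun X => ?_) j
  have := hF.lie_left Z X Y
  have hZX (W : AffineVirasoro g) : ⁅Z, W⁆ = 0 := by
    rw [← lie_skew, lie_eq_zero_of_component_eq_zero hZ, neg_zero]
  rw [hZX, hZX] at this
  rw [map_zero, LinearMap.zero_apply, zero_sub] at this
  exact neg_eq_zero.1 this.symm

theorem component_lie_eq_zero {X Y : AffineVirasoro g} (h : ∀ j, component g j Y = 0) (j : ℤ) :
    component g j ⁅X, Y⁆ = 0 := by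
  rw [lie_eq_zero_of_component_eq_zero h, map_zero]

/-- `ad d_m` from degree `n - m` to degree `n` scales the `g` part by `n - m` and the `d` part by `n
- 2m`, so it is invertible modulo the centre. This allows degrees to be changed. -/
theorem homogeneous_eq_sub_lie (m n : ℤ) (hm : n - 2 * m ≠ 0) (hn : n - m ≠ 0) (p : g × ℂ) :
    ∃ q : g × ℂ, ∀ j, component g j (homogeneous g n p - ⁅d g m, homogeneous g (n - m) q⁆) = 0 := by
  have hm' : (n : ℂ) - m - m ≠ 0 := by
    have : ((n - 2 * m : ℤ) : ℂ) ≠ 0 := by exact_mod_cast hm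
    push_cast at this
    convert this using 1; ring
  have hn' : (n : ℂ) - m ≠ 0 := by exact_mod_cast hn
  refine ⟨((n - m : ℂ)⁻¹ • p.1, (n - m - m : ℂ)⁻¹ * p.2), fun j => ?_⟩
  rw [map_sub, ← homogeneous_zero_one, component_lie_homogeneous_homogeneous, sub_eq_zero,
    show m + (n - m) = n by ring]
  congr 2
  ext
  · simp [gradedBracket, smul_smul, hn']
  · simp only [gradedBracket]
    push_cast
    field_simp

theorem component_biderivation_eq_zero [LieAlgebra.IsSimple ℂ g] (hF : IsBiderivation F)
    (h : (component g 1 (F (d g 0) (d g 1))).2 = 0) (X Y : AffineVirasoro g) (j : ℤ) :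
    component g j (F X Y) = 0 := by
  have hd (Y : AffineVirasoro g) (j : ℤ) : component g j (F (d g 0) Y) = 0 := by
    induction Y using homogeneous_induction with
    | hadd X Y hX hY => rw [map_add, map_add, hX, hY, add_zero]
    | hcentral Z hZ => exact component_biderivation_of_component_eq_zero_left hF.flip hZ _ j
    | hhom n q =>
      by_cases hj : j = n
      · subst hj
        exact component_biderivation_d_zero hF h j q
      · exact component_biderivation_d_zero_of_ne hF hj q
  have h1 {m j : ℤ} (hj : j ≠ m) (p : g × ℂ) (Y : AffineVirasoro g) :
      component g j (F (homogeneous g m p) Y) = 0 := by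
    have := sub_smul_component_biderivation hF j m p Y
    rw [hd, gradedBracket_zero_left, neg_zero] at this
    refine (smul_eq_zero.1 this).resolve_left (sub_ne_zero.2 ?_)
    exact_mod_cast hj
  -- By `h1` only degree `m` can survive. There the identity in the second argument involves degree
  -- `m - n` of `F (X, d_0)`, which is zero by `h1` as `n ≠ 0`.
  have h2 {m n : ℤ} (hmn : m ≠ n) (hn : n ≠ 0) (p q : g × ℂ) (j : ℤ) :
      component g j (F (homogeneous g m p) (homogeneous g n q)) = 0 := by
    by_cases hj : j = m
    · subst hj
      have := sub_smul_component_biderivation hF.flip j n q (homogeneous g j p)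
      rw [LinearMap.flip_apply, LinearMap.flip_apply, h1 (j := j - n) (by omega),
        gradedBracket_zero_left, neg_zero] at this
      refine (smul_eq_zero.1 this).resolve_left (sub_ne_zero.2 ?_)
      exact_mod_cast hmn
    · exact h1 hj _ _
  have h3 {n : ℤ} (hn : n ≠ 0) (m : ℤ) (p q : g × ℂ) (j : ℤ) :
      component g j (F (homogeneous g m p) (homogeneous g n q)) = 0 := by
    by_cases hmn : m = n
    · subst hmn
      -- Writing `X` through `d_(2m)` and degree `-m` makes both new degrees differ from `m`.
      obtain ⟨p', hp⟩ := homogeneous_eq_sub_lie (2 * m) m (by omega) (by omega) p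
      have := component_biderivation_of_component_eq_zero_left hF hp (homogeneous g m q) j
      rw [map_sub, LinearMap.sub_apply, map_sub, hF.lie_left, map_sub,
        component_lie_eq_zero (h2 (by omega) hn _ _), ← homogeneous_zero_one,
        component_lie_eq_zero (h2 (by omega) hn _ _), sub_zero, sub_zero] at this
      exact this
    · exact h2 hmn hn p q j
  have h4 (m n : ℤ) (p q : g × ℂ) (j : ℤ) :
      component g j (F (homogeneous g m p) (homogeneous g n q)) = 0 := by
    by_cases hn : n = 0
    · subst hn
      -- A degree 0 second argument is replaced by a bracket of degrees 1 and -1, both covered by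
      -- `h3`.
      obtain ⟨q', hq⟩ := homogeneous_eq_sub_lie 1 0 (by omega) (by omega) q
      have := component_biderivation_of_component_eq_zero_left hF.flip hq (homogeneous g m p) j
      rw [map_sub, LinearMap.sub_apply, map_sub, hF.flip.lie_left, map_sub, ← homogeneous_zero_one]
        at this
      simp only [LinearMap.flip_apply] at this
      rw [component_lie_eq_zero (h3 (by omega) _ _ _),
        component_lie_eq_zero (h3 (by omega) _ _ _), sub_zero, sub_zero] at this
      exact this
    · exact h3 hn m p q j
  induction X using homogeneous_induction with
  | hadd X X' hX hX' => rw [map_add, LinearMap.add_apply, map_add, hX, hX', add_zero]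
  | hcentral Z hZ => exact component_biderivation_of_component_eq_zero_left hF hZ _ j
  | hhom m p =>
  induction Y using homogeneous_induction with
  | hadd X X' hX hX' => rw [map_add, map_add, hX, hX', add_zero]
  | hcentral Z hZ => exact component_biderivation_of_component_eq_zero_left hF.flip hZ _ j
  | hhom n q => exact h4 m n p q j

theorem isInnerBiderivation_of_isBiderivation [FiniteDimensional ℂ g] [LieAlgebra.IsSimple ℂ g]
    (hF : IsBiderivation F) : IsInnerBiderivation F := by
  set c : ℂ := (component g 1 (F (d g 0) (d g 1))).2 with hc
  have hG := hF.sub_smul_lie c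
  set G := F - c • lieBilinear ℂ (AffineVirasoro g) with hGF
  have hcentral (X Y : AffineVirasoro g) (j : ℤ) : component g j (G X Y) = 0 := by
    refine component_biderivation_eq_zero hG ?_ X Y j
    have : ⁅d g 0, d g 1⁆ = d g 1 := by
      rw [lie_d_d]; simp
    have h1 : component g 1 (d g 1) = (0, 1) := by
      rw [← homogeneous_zero_one, component_homogeneous_self]
    simp [hGF, lieBilinear, this, h1, ← hc]
  refine ⟨c, fun X Y => ?_⟩
  -- Central values make `G X` vanish on brackets, and perfectness removes the central ambiguity.
  have h0 : G X Y = 0 := map_eq_zero_of_map_lie_eq_zero (G X) (fun Y Z => by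
    rw [hG.lie_right, lie_eq_zero_of_component_eq_zero (hcentral _ _),
      lie_eq_zero_of_component_eq_zero (hcentral _ _), sub_zero]) Y
  rw [← sub_eq_zero]
  exact h0

end AffineVirasoro

end

theorem corollary3p9 (g : Type*) [LieRing g] [LieAlgebra ℂ g] [FiniteDimensional ℂ g]
    [LieAlgebra.IsSimple ℂ g]
    (F : AffineVirasoro g →ₗ[ℂ] AffineVirasoro g →ₗ[ℂ] AffineVirasoro g)
    (hF : IsBiderivation F) :
    IsInnerBiderivation F :=
  AffineVirasoro.isInnerBiderivation_of_isBiderivation hF
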